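/- Let $\mathbb K$ be a field, $n\ge 0$, and let $S=\mathbb K[x_1,\dots,x_n]$ and $T=S[z]=\mathbb K[x_1,\dots,x_n,z]$ be standard graded polynomial rings. Let $I\subseteq S$ be a monomial ideal with minimal monomial generators $f_1,\dots,f_m$, put $d_j=\deg f_j$ and $d=\max_j d_j$, and let $$I^{\mathrm{eq}}=(f_1z^{d-d_1},\dots,f_mz^{d-d_m})\subseteq T$$ be the equification of $I$ (for $I=0$, $I^{\mathrm{eq}}=0$). Then $I$ has a minimal graded free resolution over $S$ and $I^{\mathrm{eq}}$ has one over $T$, with all modules of finite rank. Let $\beta_i^S(I)$ and $\beta_i^T(I^{\mathrm{eq}})$ denote the total Betti numbers, i.e. the ranks of the $i$-th free modules in any such resolutions. Then $$\beta_0^S(I)=\beta_0^T(I^{\mathrm{eq}})\qquad\text{and}\qquad \beta_i^S(I)\le\beta_i^T(I^{\mathrm{eq}})\quad\text{for all } i>0.$$ -/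

import Mathlib

open MvPolynomial

namespace MonomialEquification

variable {σ K : Type*} [Field K]

/-- A monomial ideal: an ideal generated by monomials. -/
def IsMonomialIdeal (I : Ideal (MvPolynomial σ K)) : Prop :=
  ∃ A : Set (σ →₀ ℕ), I = Ideal.span ((fun a => monomial a (1 : K)) '' A)

/-- The exponents of the minimal monomial generators of `I`, i.e. of the monomials in `I` that are
minimal with respect to divisibility (the order on exponent vectors is componentwise). -/
def minGens (I : Ideal (MvPolynomial σ K)) : Set (σ →₀ ℕ) :=
  {a | Minimal (fun b => monomial b (1 : K) ∈ I) a}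

theorem minGens_finite [Finite σ] (I : Ideal (MvPolynomial σ K)) : (minGens I).Finite := by
  have h : IsAntichain (· ≤ ·) (minGens I) := setOfPred_minimal_antichain _
  exact WellQuasiOrderedLE.finite_of_isAntichain h

/-- The maximum of the degrees of the minimal monomial generators of `I`
(and `0` when there are none, i.e. for the zero ideal). -/
noncomputable def maxDegree [Finite σ] (I : Ideal (MvPolynomial σ K)) : ℕ :=
  (minGens_finite I).toFinset.sup Finsupp.degree

/-- The equification of `I`, in the polynomial ring with one extra variable `z = X none`:
it is generated by the `f * z ^ (d - deg f)`, for `f` a minimal monomial generator of `I`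
and `d` the largest degree of a minimal monomial generator. -/
noncomputable def equification [Finite σ] (I : Ideal (MvPolynomial σ K)) :
    Ideal (MvPolynomial (Option σ) K) :=
  Ideal.span ((fun a : σ →₀ ℕ =>
    rename some (monomial a (1 : K)) * X none ^ (maxDegree I - a.degree)) '' minGens I)

/-- `v` is homogeneous of degree `t` in the graded free module `⨁ₖ S(-shift k)`, in which
the `k`-th basis vector has degree `shift k` (the zero vector is homogeneous of every degree). -/
def IsHomogeneousVec {r : ℕ} (shift : Fin r → ℤ) (t : ℤ) (v : Fin r → MvPolynomial σ K) : Prop :=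
  ∀ k, ∀ m ∈ (v k).support, (m.degree : ℤ) + shift k = t

/-- A minimal graded free resolution `⋯ → F₂ → F₁ → F₀ → I → 0` of the ideal `I` of the standard
graded polynomial ring `S`, where `Fᵢ = ⨁ₖ S(-shift i k)` is a sum of `rank i` copies of `S`. -/
structure MinimalGradedFreeResolution (I : Ideal (MvPolynomial σ K)) where
  rank : ℕ → ℕ
  shift : ∀ i, Fin (rank i) → ℤ
  d : ∀ i, (Fin (rank (i + 1)) → MvPolynomial σ K) →ₗ[MvPolynomial σ K]
    (Fin (rank i) → MvPolynomial σ K)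
  ε : (Fin (rank 0) → MvPolynomial σ K) →ₗ[MvPolynomial σ K] I
  ε_surjective : Function.Surjective ε
  exact_zero : Function.Exact (d 0) ε
  exact_succ : ∀ i, Function.Exact (d (i + 1)) (d i)
  /-- the differentials preserve degrees -/
  d_graded : ∀ i t v, IsHomogeneousVec (shift (i + 1)) t v → IsHomogeneousVec (shift i) t (d i v)
  /-- the augmentation preserves degrees -/
  ε_graded : ∀ t v, IsHomogeneousVec (shift 0) t v →
    ∀ m ∈ (ε v : MvPolynomial σ K).support, (m.degree : ℤ) = t
  /-- minimality: the image of each differential lies in `𝔪 F`, with `𝔪` generated by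
  the variables -/
  minimal : ∀ i, LinearMap.range (d i) ≤
    idealOfVars σ K • (⊤ : Submodule (MvPolynomial σ K) (Fin (rank i) → MvPolynomial σ K))

/-- The graded Betti number `β_{i,j}`, read off from a minimal graded free resolution:
the number of summands `S(-j)` of the `i`-th module. -/
def MinimalGradedFreeResolution.gradedBetti {I : Ideal (MvPolynomial σ K)}
    (F : MinimalGradedFreeResolution I) (i : ℕ) (j : ℤ) : ℕ :=
  (Finset.univ.filter fun k => F.shift i k = j).card

/-- The total Betti number `β_i = ∑_j β_{i,j}`, read off from a minimal graded free resolution. -/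
noncomputable def MinimalGradedFreeResolution.betti {I : Ideal (MvPolynomial σ K)}
    (F : MinimalGradedFreeResolution I) (i : ℕ) : ℕ :=
  ∑ᶠ j : ℤ, F.gradedBetti i j

/-- The total Betti number is the rank of the `i`-th module. -/
theorem MinimalGradedFreeResolution.betti_eq_rank {I : Ideal (MvPolynomial σ K)}
    (F : MinimalGradedFreeResolution I) (i : ℕ) : F.betti i = F.rank i := by
  have hs : (Function.support fun j => F.gradedBetti i j) ⊆
      ((Finset.univ.image (F.shift i) : Finset ℤ) : Set ℤ) := by
    intro j hj
    obtain ⟨k, hk⟩ := Finset.card_pos.mp (Nat.pos_of_ne_zero hj)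
    simpa using ⟨k, by simpa using hk⟩
  unfold MinimalGradedFreeResolution.betti
  rw [finsum_eq_sum_of_support_subset _ hs]
  simp only [MinimalGradedFreeResolution.gradedBetti]
  rw [← Finset.card_eq_sum_card_fiberwise (fun k _ => by simp), Finset.card_univ,
    Fintype.card_fin]

end MonomialEquification

namespace MonomialEquification

/-! Setting `z = 1` sends `I^eq` onto `I`, and `z - 1` is a non-zero-divisor both on `T` and modulo
the monomial ideal `I^eq` (`IsMonomialIdeal.mem_of_X_sub_one_mul_mem`). Hence reducing a resolution
of `I^eq` modulo `z - 1` gives a free resolution of `I` over `S` with the same ranks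
(`exact_baseChange`). It need be neither graded nor minimal, but a minimal resolution has the
smallest ranks among all free resolutions: chain maps in both directions compose to a map homotopic
to the identity, hence equal to it modulo `𝔪` (`rank_le_of_minimal`). This yields `β_i(I) ≤
β_i(I^eq)` for every `i`.

For the reverse inequality at `i = 0`, the number of minimal monomial generators of `I` lies
between: `I^eq` is generated by that many elements, and `I` by no fewer
(`rank_zero_equification_le`, `ncard_minGens_le`).

Resolutions exist by iterating graded covers with the least number of homogeneous generators; the
kernel of such a cover lies in `𝔪F`. -/

theorem exists_dependent_seq {α : ℕ → Type*} (P : ∀ i, α i → Prop)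
    (r : ∀ i, α i → α (i + 1) → Prop) (h₀ : ∃ a, P 0 a)
    (h : ∀ i a, P i a → ∃ b, P (i + 1) b ∧ r i a b) :
    ∃ f : ∀ i, α i, P 0 (f 0) ∧ ∀ i, r i (f i) (f (i + 1)) := by
  obtain ⟨a₀, ha₀⟩ := h₀
  choose g hg using h
  let f : ∀ i, {a : α i // P i a} :=
    fun i => Nat.rec ⟨a₀, ha₀⟩ (fun i a => ⟨g i a.1 a.2, (hg i a.1 a.2).1⟩) i
  exact ⟨fun i => (f i).1, ha₀, fun i => (hg i (f i).1 (f i).2).2⟩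

/-! ### Comparison of resolutions and minimality of ranks -/

section Comparison

variable {R : Type*} [CommRing R]

theorem exists_comp_eq_of_range_le {P N M : Type*} [AddCommGroup P] [AddCommGroup N]
    [AddCommGroup M] [Module R P] [Module R N] [Module R M] [Module.Projective R P]
    (f : P →ₗ[R] M) (g : N →ₗ[R] M) (h : ∀ x, f x ∈ LinearMap.range g) :
    ∃ l : P →ₗ[R] N, ∀ x, g (l x) = f x := by
  obtain ⟨l, hl⟩ := Module.projective_lifting_property g.rangeRestrict
    (f.codRestrict (LinearMap.range g) h) g.surjective_rangeRestrict
  exact ⟨l, fun x => congrArg Subtype.val (LinearMap.congr_fun hl x)⟩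

theorem mem_of_mem_smul_top {ι : Type*} {J : Ideal R} {x : ι → R}
    (hx : x ∈ J • (⊤ : Submodule R (ι → R))) (k : ι) : x k ∈ J := by
  induction hx using Submodule.smul_induction_on' with
  | smul r hr n _ => exact J.mul_mem_right _ hr
  | add x _ y _ hx hy => exact J.add_mem hx hy

theorem mem_smul_top_of_forall_mem {ι : Type*} [Finite ι] {J : Ideal R} {x : ι → R}
    (hx : ∀ k, x k ∈ J) : x ∈ J • (⊤ : Submodule R (ι → R)) := by
  classical
  have := Fintype.ofFinite ι
  rw [pi_eq_sum_univ' x]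
  exact Submodule.sum_mem _ fun k _ => Submodule.smul_mem_smul (hx k) trivial

theorem map_mem_smul_top {M N : Type*} [AddCommGroup M] [AddCommGroup N] [Module R M]
    [Module R N] {J : Ideal R} (f : M →ₗ[R] N) {x : M} (hx : x ∈ J • (⊤ : Submodule R M)) :
    f x ∈ J • (⊤ : Submodule R N) := by
  have : f x ∈ (J • (⊤ : Submodule R M)).map f := Submodule.mem_map_of_mem hx
  rw [Submodule.map_smul''] at this
  exact Submodule.smul_mono le_rfl le_top this

/-- If the identity of `R ^ a` factors through `R ^ b` modulo a proper ideal, then `a ≤ b`. -/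
theorem le_of_comp_sub_id_mem {a b : ℕ} {J : Ideal R} (hJ : J ≠ ⊤)
    (φ : (Fin a → R) →ₗ[R] (Fin b → R)) (ψ : (Fin b → R) →ₗ[R] (Fin a → R))
    (h : ∀ x, ψ (φ x) - x ∈ J • (⊤ : Submodule R (Fin a → R))) : a ≤ b := by
  have : Nontrivial (R ⧸ J) := Ideal.Quotient.nontrivial_iff.mpr hJ
  set A := (LinearMap.toMatrix' φ).map (Ideal.Quotient.mk J)
  set B := (LinearMap.toMatrix' ψ).map (Ideal.Quotient.mk J)
  have hBA : B * A = 1 := by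
    rw [← Matrix.map_mul, ← LinearMap.toMatrix'_comp]
    ext i j
    have hij := mem_of_mem_smul_top (h (Pi.single j 1)) i
    rw [Pi.sub_apply, ← Ideal.Quotient.eq] at hij
    rw [Matrix.map_apply, LinearMap.toMatrix'_apply, LinearMap.comp_apply, hij,
      Matrix.one_apply, Pi.single_apply]
    split_ifs <;> simp
  -- Over a nontrivial commutative ring, an injection of finite free modules cannot lower the rank.
  refine le_of_fin_injective (R ⧸ J) (Matrix.toLin' A)
    (Function.LeftInverse.injective (g := Matrix.toLin' B) fun x => ?_)
  rw [← Matrix.toLin'_mul_apply, hBA, Matrix.toLin'_one, LinearMap.id_apply]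

variable {F G : ℕ → Type*} [∀ i, AddCommGroup (F i)] [∀ i, Module R (F i)]
  [∀ i, AddCommGroup (G i)] [∀ i, Module R (G i)] {M : Type*} [AddCommGroup M] [Module R M]

/-- The comparison theorem: existence of a chain map between projective resolutions. -/
theorem exists_chain_map [∀ i, Module.Projective R (F i)]
    (d : ∀ i, F (i + 1) →ₗ[R] F i) (ε : F 0 →ₗ[R] M) (d' : ∀ i, G (i + 1) →ₗ[R] G i)
    (ε' : G 0 →ₗ[R] M) (hε : ∀ x, ε x ∈ LinearMap.range ε')
    (h₀ : ∀ x, ε (d 0 x) = 0) (h : ∀ i x, d i (d (i + 1) x) = 0)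
    (h₀' : Function.Exact (d' 0) ε') (h' : ∀ i, Function.Exact (d' (i + 1)) (d' i)) :
    ∃ φ : ∀ i, F i →ₗ[R] G i, (∀ x, ε' (φ 0 x) = ε x) ∧
      ∀ i x, d' i (φ (i + 1) x) = φ i (d i x) := by
  obtain ⟨φ₀, hφ₀⟩ := exists_comp_eq_of_range_le ε ε' hε
  -- Only degree zero carries a condition of its own; compatibility in higher degrees is the
  -- relation between consecutive terms.
  let P : ∀ i, (F i →ₗ[R] G i) → Prop
    | 0, f => ∀ x, ε' (f x) = ε x
    | _ + 1, _ => True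
  obtain ⟨φ, hφ, hφ'⟩ := exists_dependent_seq (α := fun i => F i →ₗ[R] G i)
    (fun i f => P i f ∧ ∀ x, f (d i x) ∈ LinearMap.range (d' i))
    (fun i f g => ∀ x, d' i (g x) = f (d i x))
    ⟨φ₀, hφ₀, fun x => (h₀' _).mp (by rw [hφ₀, h₀])⟩ (fun i f hf => by
      obtain ⟨g, hg⟩ := exists_comp_eq_of_range_le (f ∘ₗ d i) (d' i) hf.2
      exact ⟨g, ⟨trivial, fun x => (h' i _).mp (by simp [hg, h])⟩, hg⟩)
  exact ⟨φ, hφ.1, hφ'⟩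

/-- A chain endomorphism of a projective resolution lifting zero is null-homotopic; if the
resolution is minimal, such a chain map vanishes modulo the ideal. -/
theorem chain_map_mem_smul_top [∀ i, Module.Projective R (F i)] {J : Ideal R}
    (d : ∀ i, F (i + 1) →ₗ[R] F i) (ε : F 0 →ₗ[R] M)
    (h₀ : Function.Exact (d 0) ε) (h : ∀ i, Function.Exact (d (i + 1)) (d i))
    (hmin : ∀ i x, d i x ∈ J • (⊤ : Submodule R (F i)))
    (g : ∀ i, F i →ₗ[R] F i) (hg₀ : ∀ x, ε (g 0 x) = 0)
    (hg : ∀ i x, d i (g (i + 1) x) = g i (d i x)) (i : ℕ) (x : F i) :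
    g i x ∈ J • (⊤ : Submodule R (F i)) := by
  obtain ⟨s₀, hs₀⟩ := exists_comp_eq_of_range_le (g 0) (d 0) fun x => (h₀ _).mp (hg₀ x)
  let P : ∀ i, (F i →ₗ[R] F (i + 1)) → Prop
    | 0, f => ∀ x, d 0 (f x) = g 0 x
    | _ + 1, _ => True
  obtain ⟨s, hs, hs'⟩ := exists_dependent_seq (α := fun i => F i →ₗ[R] F (i + 1))
    (fun i f => P i f ∧ ∀ x, g (i + 1) x - f (d i x) ∈ LinearMap.range (d (i + 1)))
    (fun i f f' => ∀ x, d (i + 1) (f' x) = g (i + 1) x - f (d i x))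
    ⟨s₀, hs₀, fun x => (h 0 _).mp (by rw [map_sub, hs₀, hg, sub_self])⟩ (fun i f hf => by
      obtain ⟨f', hf'⟩ := exists_comp_eq_of_range_le (g (i + 1) - f ∘ₗ d i) (d (i + 1)) hf.2
      refine ⟨f', ⟨trivial, fun x => (h (i + 1) _).mp ?_⟩, hf'⟩
      rw [map_sub, hf', hg, LinearMap.sub_apply, LinearMap.comp_apply,
        (h i).apply_apply_eq_zero, map_zero, sub_zero, sub_self])
  cases i with
  | zero => rw [← hs.1 x]; exact hmin _ _
  | succ i =>
    -- The homotopy formula `g = ds + sd`: both terms lie in `J F` because `d` does.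
    rw [← sub_add_cancel (g (i + 1) x) (s i (d i x)), ← hs' i x]
    exact add_mem (hmin _ _) (map_mem_smul_top _ (hmin _ _))

/-- A minimal resolution has the smallest ranks among all free resolutions. -/
theorem rank_le_of_minimal {r s : ℕ → ℕ} {J : Ideal R} (hJ : J ≠ ⊤)
    (d : ∀ i, (Fin (r (i + 1)) → R) →ₗ[R] (Fin (r i) → R)) (ε : (Fin (r 0) → R) →ₗ[R] M)
    (h₀ : Function.Exact (d 0) ε) (h : ∀ i, Function.Exact (d (i + 1)) (d i))
    (hmin : ∀ i x, d i x ∈ J • (⊤ : Submodule R (Fin (r i) → R)))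
    (d' : ∀ i, (Fin (s (i + 1)) → R) →ₗ[R] (Fin (s i) → R)) (ε' : (Fin (s 0) → R) →ₗ[R] M)
    (h₀' : Function.Exact (d' 0) ε') (h' : ∀ i, Function.Exact (d' (i + 1)) (d' i))
    (hε : LinearMap.range ε = LinearMap.range ε') (i : ℕ) : r i ≤ s i := by
  obtain ⟨φ, hφ₀, hφ⟩ := exists_chain_map (F := fun i => Fin (r i) → R)
    (G := fun i => Fin (s i) → R) d ε d' ε'
    (fun x => hε.le ⟨x, rfl⟩) (fun x => h₀.apply_apply_eq_zero x)
    (fun i x => (h i).apply_apply_eq_zero x) h₀' h'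
  obtain ⟨ψ, hψ₀, hψ⟩ := exists_chain_map (F := fun i => Fin (s i) → R)
    (G := fun i => Fin (r i) → R) d' ε' d ε
    (fun x => hε.ge ⟨x, rfl⟩) (fun x => h₀'.apply_apply_eq_zero x)
    (fun i x => (h' i).apply_apply_eq_zero x) h₀ h
  refine le_of_comp_sub_id_mem hJ (φ i) (ψ i) fun x => ?_
  exact chain_map_mem_smul_top (F := fun i => Fin (r i) → R) d ε h₀ h hmin (fun i => ψ i ∘ₗ φ i - LinearMap.id)
    (fun x => by simp [hψ₀, hφ₀]) (fun i x => by simp [hψ, hφ]) i x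

/-- A minimal system of generators has the smallest cardinality. -/
theorem rank_zero_le_of_minimal {a b : ℕ} {J : Ideal R} (hJ : J ≠ ⊤)
    (ε : (Fin a → R) →ₗ[R] M) (hmin : ∀ x, ε x = 0 → x ∈ J • (⊤ : Submodule R (Fin a → R)))
    (ε' : (Fin b → R) →ₗ[R] M) (hε : LinearMap.range ε = LinearMap.range ε') : a ≤ b := by
  obtain ⟨φ, hφ⟩ := exists_comp_eq_of_range_le ε ε' fun x => hε.le ⟨x, rfl⟩
  obtain ⟨ψ, hψ⟩ := exists_comp_eq_of_range_le ε' ε fun x => hε.ge ⟨x, rfl⟩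
  exact le_of_comp_sub_id_mem hJ φ ψ fun x => hmin _ (by rw [map_sub, hψ, hφ, sub_self])

end Comparison

/-! ### Reduction modulo a non-zero-divisor -/

section BaseChange

variable {T S : Type*} [CommRing T] [CommRing S]

/-- Base change of a map of free modules. -/
theorem exists_baseChange_linearMap (π : T →+* S) {a b : ℕ}
    (f : (Fin a → T) →ₗ[T] (Fin b → T)) :
    ∃ g : (Fin a → S) →ₗ[S] (Fin b → S), ∀ v : Fin a → T, g (π ∘ v) = π ∘ f v := by
  refine ⟨Matrix.toLin' ((LinearMap.toMatrix' f).map π), fun v => ?_⟩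
  ext k
  have h : f v k = ∑ i, LinearMap.toMatrix' f k i * v i := by
    conv_lhs => rw [← Matrix.toLin'_toMatrix' f]
    rfl
  rw [Function.comp_apply, h, map_sum]
  simp only [map_mul]
  rfl

/-- Reduction modulo a non-zero-divisor `z` preserves exactness of complexes of free modules when
`z` is also a non-zero-divisor modulo the image of the last map. -/
theorem exact_baseChange {π : T →+* S} (hπ : Function.Surjective π) {z : T}
    (hker : ∀ t, π t = 0 → ∃ u, t = z * u) (hz : π z = 0) {a b c : ℕ}
    (f : (Fin a → T) →ₗ[T] (Fin b → T)) (g : (Fin b → T) →ₗ[T] (Fin c → T))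
    (hfg : Function.Exact f g) (hreg : ∀ w, z • w ∈ LinearMap.range g → w ∈ LinearMap.range g)
    (f' : (Fin a → S) →ₗ[S] (Fin b → S)) (g' : (Fin b → S) →ₗ[S] (Fin c → S))
    (hf : ∀ v, f' (π ∘ v) = π ∘ f v) (hg : ∀ v, g' (π ∘ v) = π ∘ g v) :
    Function.Exact f' g' := by
  intro y
  constructor
  · intro hy
    obtain ⟨v, rfl⟩ : ∃ v, π ∘ v = y := hπ.comp_left y
    rw [hg] at hy
    -- Here `g v = z w`, and regularity gives `w = g u`; thus `v - z u` is a cycle with the same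
    -- reduction as `v`.
    choose w hw using fun k => hker (g v k) (congrFun hy k)
    obtain ⟨u, hu⟩ := hreg w ⟨v, funext hw⟩
    obtain ⟨x, hx⟩ := (hfg (v - z • u)).mp (by
      rw [map_sub, map_smul, hu, sub_eq_zero]; exact funext hw)
    refine ⟨π ∘ x, ?_⟩
    rw [hf, hx]
    ext k
    simp [hz]
  · rintro ⟨x, rfl⟩
    obtain ⟨v, rfl⟩ : ∃ v, π ∘ v = x := hπ.comp_left x
    rw [hf, hg, hfg.apply_apply_eq_zero]
    ext k
    simp

/-- The image is the kernel of a map into a torsion-free module. This supplies the regularity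
hypothesis of `exact_baseChange` away from the augmentation. -/
theorem mem_range_of_smul_mem_range [IsDomain T] {z : T} (hz : z ≠ 0) {a b c : ℕ}
    {f : (Fin a → T) →ₗ[T] (Fin b → T)} {g : (Fin b → T) →ₗ[T] (Fin c → T)}
    (hfg : Function.Exact f g) (w : Fin b → T) (hw : z • w ∈ LinearMap.range f) :
    w ∈ LinearMap.range f := by
  have h := (hfg _).mpr hw
  rw [map_smul] at h
  exact (hfg w).mp ((smul_eq_zero.mp h).resolve_left hz)

end BaseChange

/-! ### Monomial ideals and the specialization `z = 1` -/

section MonomialIdeal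

variable {σ K : Type*} [Field K]

theorem IsMonomialIdeal.mem_iff {I : Ideal (MvPolynomial σ K)} (hI : IsMonomialIdeal I)
    {p : MvPolynomial σ K} : p ∈ I ↔ ∀ m ∈ p.support, monomial m (1 : K) ∈ I := by
  obtain ⟨A, rfl⟩ := hI
  classical
  rw [mem_ideal_span_monomial_image]
  refine forall₂_congr fun m _ => ?_
  rw [mem_ideal_span_monomial_image, support_monomial, if_neg one_ne_zero]
  simp

theorem mem_idealOfVars_iff {p : MvPolynomial σ K} :
    p ∈ idealOfVars σ K ↔ coeff 0 p = 0 := by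
  rw [← pow_one (idealOfVars σ K), mem_pow_idealOfVars_iff']
  simp [Finsupp.degree_eq_zero_iff]

theorem idealOfVars_ne_top : idealOfVars σ K ≠ ⊤ := by
  rw [Ideal.ne_top_iff_one, mem_idealOfVars_iff]
  simp

theorem minimal_of_mem_minGens {I : Ideal (MvPolynomial σ K)} {a : σ →₀ ℕ}
    (ha : a ∈ minGens I) : Minimal (fun b => monomial b (1 : K) ∈ I) a :=
  ha

theorem IsMonomialIdeal.eq_span_minGens [Finite σ] {I : Ideal (MvPolynomial σ K)}
    (hI : IsMonomialIdeal I) :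
    I = Ideal.span ((fun a => monomial a (1 : K)) '' minGens I) := by
  apply le_antisymm
  · intro p hp
    rw [mem_ideal_span_monomial_image]
    intro m hm
    obtain ⟨a, ham, ha⟩ := exists_minimal_le_of_wellFoundedLT
      (fun b => monomial b (1 : K) ∈ I) m (hI.mem_iff.mp hp m hm)
    exact ⟨a, ha, ham⟩
  · rw [Ideal.span_le]
    rintro _ ⟨a, ha, rfl⟩
    exact (minimal_of_mem_minGens ha).prop

theorem rename_monomial_mul_X_pow (a : σ →₀ ℕ) (k : ℕ) :
    rename some (monomial a (1 : K)) * X none ^ k =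
      monomial (a.mapDomain some + Finsupp.single none k) (1 : K) := by
  rw [rename_monomial, X_pow_eq_monomial, monomial_mul, one_mul]

theorem isMonomialIdeal_equification [Finite σ] (I : Ideal (MvPolynomial σ K)) :
    IsMonomialIdeal (equification I) := by
  refine ⟨(fun a => a.mapDomain some + Finsupp.single none (maxDegree I - a.degree)) ''
    minGens I, ?_⟩
  rw [equification, Set.image_image]
  simp only [rename_monomial_mul_X_pow]

/-- The specialization `z = 1`. -/
noncomputable def specializeOne (σ K : Type*) [Field K] :
    MvPolynomial (Option σ) K →ₐ[K] MvPolynomial σ K :=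
  aeval fun o => o.elim 1 X

theorem specializeOne_rename (p : MvPolynomial σ K) :
    specializeOne σ K (rename some p) = p := by
  rw [specializeOne, aeval_rename]
  exact aeval_X_left_apply p

theorem specializeOne_X_none : specializeOne σ K (X none) = 1 := by
  simp [specializeOne]

theorem specializeOne_surjective : Function.Surjective (specializeOne σ K) :=
  fun p => ⟨_, specializeOne_rename p⟩

/-- The quotient map modulo `z - 1` factors through the specialization, as one checks on variables.
-/
theorem exists_eq_mul_of_specializeOne_eq_zero {p : MvPolynomial (Option σ) K}
    (hp : specializeOne σ K p = 0) : ∃ u, p = (X none - 1) * u := by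
  let q := Ideal.Quotient.mkₐ K (Ideal.span {(X none - 1 : MvPolynomial (Option σ) K)})
  have h : q = (q.comp (rename some)).comp (specializeOne σ K) := by
    apply MvPolynomial.algHom_ext
    rintro (_ | i)
    · rw [AlgHom.comp_apply, specializeOne_X_none, map_one, ← map_one q]
      exact Ideal.Quotient.eq.mpr (Ideal.mem_span_singleton_self _)
    · simp [specializeOne]
  have hq : q p = 0 := by rw [h, AlgHom.comp_apply, hp, map_zero]
  exact Ideal.mem_span_singleton.mp (Ideal.Quotient.eq_zero_iff_mem.mp hq)

theorem map_specializeOne_equification [Finite σ] {I : Ideal (MvPolynomial σ K)}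
    (hI : IsMonomialIdeal I) :
    (equification I).map (specializeOne σ K : MvPolynomial (Option σ) K →+* _) = I := by
  conv_rhs => rw [hI.eq_span_minGens]
  rw [equification, Ideal.map_span, Set.image_image]
  simp [specializeOne_rename, specializeOne_X_none]

/-- `z - 1` is a non-zero-divisor modulo a monomial ideal. -/
theorem IsMonomialIdeal.mem_of_X_sub_one_mul_mem {J : Ideal (MvPolynomial σ K)}
    (hJ : IsMonomialIdeal J) (i : σ) {t : MvPolynomial σ K} (ht : (X i - 1) * t ∈ J) :
    t ∈ J := by
  classical
  rw [hJ.mem_iff]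
  -- Induction on the exponent of `X i`. The coefficient of `m` in `(X i - 1) * t` is `t_{m - e_i} -
  -- t_m`: if it is nonzero, `m` is in `J`; otherwise `m - e_i` is in the support of `t`, and
  -- induction applies.
  suffices h : ∀ k : ℕ, ∀ m, m i = k → m ∈ t.support → monomial m (1 : K) ∈ J from
    fun m hm => h _ m rfl hm
  intro k
  induction k with
  | zero =>
    intro m hmi hm
    refine hJ.mem_iff.mp ht m ?_
    rw [mem_support_iff, sub_mul, one_mul, coeff_sub, coeff_X_mul', if_neg (by simpa using hmi),
      zero_sub, neg_ne_zero]
    exact mem_support_iff.mp hm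
  | succ k ih =>
    intro m hmi hm
    by_contra hmJ
    have h0 : coeff m ((X i - 1) * t) = 0 := by
      by_contra h
      exact hmJ (hJ.mem_iff.mp ht m (mem_support_iff.mpr h))
    rw [sub_mul, one_mul, coeff_sub, coeff_X_mul', if_pos (by simp [hmi]), sub_eq_zero] at h0
    have hle : Finsupp.single i 1 ≤ m := by
      rw [Finsupp.single_le_iff]; omega
    have := ih (m - Finsupp.single i 1) (by simp [hmi])
      (by rw [mem_support_iff, h0]; exact mem_support_iff.mp hm)
    apply hmJ
    rw [← add_tsub_cancel_of_le hle, ← one_mul (1 : K), ← monomial_mul]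
    exact J.mul_mem_left _ this

/-- A minimal generator is not a product of a nonconstant monomial and a monomial of `I`. Thus these
coefficients are functionals on `I / 𝔪I`. -/
theorem coeff_eq_zero_of_mem_smul_top {I : Ideal (MvPolynomial σ K)}
    (hI : IsMonomialIdeal I) {a : σ →₀ ℕ} (ha : a ∈ minGens I) {p : I}
    (hp : p ∈ idealOfVars σ K • (⊤ : Submodule (MvPolynomial σ K) I)) :
    coeff a (p : MvPolynomial σ K) = 0 := by
  classical
  induction hp using Submodule.smul_induction_on' with
  | smul r hr q _ =>
    rw [Submodule.coe_smul, smul_eq_mul, coeff_mul]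
    refine Finset.sum_eq_zero fun x hx => ?_
    replace hx : x.1 + x.2 = a :=
      Finset.HasAntidiagonal.mem_antidiagonal.mp hx
    by_contra h
    have hq := hI.mem_iff.mp q.2 x.2 (mem_support_iff.mpr (right_ne_zero_of_mul h))
    have hxa : a ≤ x.2 := (minimal_of_mem_minGens ha).le_of_le hq (hx ▸ le_add_self)
    have hx1 : x.1 = 0 := by
      have : x.1 + x.2 ≤ 0 + x.2 := by rw [hx, zero_add]; exact hxa
      exact le_antisymm (le_of_add_le_add_right this) zero_le
    exact left_ne_zero_of_mul h (hx1 ▸ mem_idealOfVars_iff.mp hr)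
  | add x _ y _ hx hy => rw [Submodule.coe_add, coeff_add, hx, hy, add_zero]

/-- A monomial ideal cannot be generated by fewer elements than its minimal monomial generators. -/
theorem ncard_minGens_le [Finite σ] {I : Ideal (MvPolynomial σ K)} (hI : IsMonomialIdeal I)
    {r : ℕ} (ε : (Fin r → MvPolynomial σ K) →ₗ[MvPolynomial σ K] I)
    (hε : Function.Surjective ε) : (minGens I).ncard ≤ r := by
  have := (minGens_finite I).fintype
  let L : (Fin r → K) →ₗ[K] (minGens I → K) :=
    { toFun := fun c a => coeff a.1 (ε (fun k => C (c k)) : MvPolynomial σ K)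
      map_add' := fun c c' => by
        ext a
        have : (fun k => C (σ := σ) ((c + c') k)) = (fun k => C (c k)) + fun k => C (c' k) := by
          ext1 k; simp
        rw [this, map_add, Submodule.coe_add, coeff_add]
        rfl
      map_smul' := fun b c => by
        ext a
        have : (fun k => C (σ := σ) ((b • c) k)) = (C b : MvPolynomial σ K) • fun k => C (c k) := by
          ext1 k; simp
        rw [this, map_smul, Submodule.coe_smul, smul_eq_mul, coeff_C_mul]
        rfl }
  have hL : Function.Surjective L := by
    intro y
    have hp : ∑ a : minGens I, monomial a.1 (y a) ∈ I := by
      refine I.sum_mem fun a _ => ?_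
      have := I.mul_mem_left (C (y a)) (minimal_of_mem_minGens a.2).prop
      rwa [C_mul_monomial, mul_one] at this
    obtain ⟨v, hv⟩ := hε ⟨_, hp⟩
    -- Keeping only the constant terms of `v` changes `ε v` by an element of `𝔪I`, invisible to
    -- these coefficients.
    refine ⟨fun k => coeff 0 (v k), ?_⟩
    ext a
    have hw : v - (fun k => C (coeff 0 (v k))) ∈
        idealOfVars σ K • (⊤ : Submodule (MvPolynomial σ K) (Fin r → MvPolynomial σ K)) :=
      mem_smul_top_of_forall_mem fun k => mem_idealOfVars_iff.mpr (by simp)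
    have h := coeff_eq_zero_of_mem_smul_top hI a.2 (map_mem_smul_top ε hw)
    rw [map_sub, hv, Submodule.coe_sub, coeff_sub, sub_eq_zero] at h
    change coeff a.1 (ε _ : MvPolynomial σ K) = _
    classical
    rw [← h]
    simp only [coeff_sum, coeff_monomial, Subtype.coe_inj]
    simp
  have := LinearMap.finrank_le_finrank_of_surjective hL
  rw [Module.finrank_fin_fun, Module.finrank_fintype_fun_eq_card] at this
  rwa [← Nat.card_coe_set_eq, Nat.card_eq_fintype_card]

end MonomialIdeal

/-! ### The two Betti number inequalities -/

section Betti

variable {σ K : Type*} [Field K] [Finite σ] {I : Ideal (MvPolynomial σ K)}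

theorem rank_zero_equification_le
    (G : MinimalGradedFreeResolution (equification I)) : G.rank 0 ≤ (minGens I).ncard := by
  have := (minGens_finite I).fintype
  let e : Fin (minGens I).ncard ≃ minGens I :=
    (finCongr (by rw [← Nat.card_coe_set_eq, Nat.card_eq_fintype_card])).trans
      (Fintype.equivFin (minGens I)).symm
  refine rank_zero_le_of_minimal (idealOfVars_ne_top (σ := Option σ) (K := K))
    ((equification I).subtype ∘ₗ G.ε) (fun x hx => ?_)
    (Fintype.linearCombination (MvPolynomial (Option σ) K) fun k =>
      rename some (monomial (e k).1 (1 : K)) * X none ^ (maxDegree I - (e k).1.degree)) ?_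
  · exact G.minimal 0 ((G.exact_zero x).mp (Subtype.ext hx))
  · rw [LinearMap.range_comp, LinearMap.range_eq_top.mpr G.ε_surjective, Submodule.map_top,
      Submodule.range_subtype, Fintype.range_linearCombination, equification, Ideal.span]
    congr 1
    ext p
    constructor
    · rintro ⟨a, ha, rfl⟩
      exact ⟨e.symm ⟨a, ha⟩, by simp⟩
    · rintro ⟨k, rfl⟩
      exact ⟨_, (e k).2, rfl⟩

theorem rank_le_rank_equification (hI : IsMonomialIdeal I) (F : MinimalGradedFreeResolution I)
    (G : MinimalGradedFreeResolution (equification I)) (i : ℕ) : F.rank i ≤ G.rank i := by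
  let π : MvPolynomial (Option σ) K →+* MvPolynomial σ K := specializeOne σ K
  have hπ : Function.Surjective π := specializeOne_surjective
  have hz : π (X none - 1) = 0 := by
    rw [map_sub, map_one, sub_eq_zero]; exact specializeOne_X_none
  have hz0 : (X none - 1 : MvPolynomial (Option σ) K) ≠ 0 := by
    intro h
    have := congrArg (coeff 0) h
    simp at this
  have hker : ∀ t, π t = 0 → ∃ u, t = (X none - 1) * u :=
    fun t ht => exists_eq_mul_of_specializeOne_eq_zero ht
  -- Embedding the ideal in a free module of rank one makes the augmentation a map of free modules,
  -- so that base change applies to it too.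
  let ι : equification I →ₗ[MvPolynomial (Option σ) K] (Fin 1 → MvPolynomial (Option σ) K) :=
    LinearMap.pi fun _ => (equification I).subtype
  have hι : Function.Injective ι := fun x y h => Subtype.ext (congrFun h 0)
  choose d' hd' using fun i => exists_baseChange_linearMap π (G.d i)
  obtain ⟨ε', hε'⟩ := exists_baseChange_linearMap π (ι ∘ₗ G.ε)
  let κ : I →ₗ[MvPolynomial σ K] (Fin 1 → MvPolynomial σ K) := LinearMap.pi fun _ => I.subtype
  have hκ : Function.Injective κ := fun x y h => Subtype.ext (congrFun h 0)
  have hG0 : Function.Exact (G.d 0) (ι ∘ₗ G.ε) := G.exact_zero.comp_injective ι hι (map_zero ι)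
  refine rank_le_of_minimal idealOfVars_ne_top F.d (κ ∘ₗ F.ε)
    (F.exact_zero.comp_injective κ hκ (map_zero κ)) F.exact_succ
    (fun i x => F.minimal i ⟨x, rfl⟩) d' ε' ?_ ?_ ?_ i
  · refine exact_baseChange hπ hker hz _ _ hG0 (fun w hw => ?_) _ _ (hd' 0) hε'
    obtain ⟨x, hx⟩ := hw
    have hw : w 0 ∈ equification I :=
      (isMonomialIdeal_equification I).mem_of_X_sub_one_mul_mem none
        (by rw [← smul_eq_mul, ← Pi.smul_apply, ← hx]; exact (G.ε x).2)
    obtain ⟨y, hy⟩ := G.ε_surjective ⟨_, hw⟩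
    refine ⟨y, ?_⟩
    ext1 k
    rw [Subsingleton.elim k 0]
    exact congrArg Subtype.val hy
  · intro i
    refine exact_baseChange hπ hker hz _ _ (G.exact_succ i) (fun w hw => ?_) _ _
      (hd' (i + 1)) (hd' i)
    cases i with
    | zero => exact mem_range_of_smul_mem_range hz0 hG0 w hw
    | succ i => exact mem_range_of_smul_mem_range hz0 (G.exact_succ i) w hw
  · apply le_antisymm
    · rintro _ ⟨x, rfl⟩
      have hx : (F.ε x : MvPolynomial σ K) ∈ (equification I).map π := by
        rw [map_specializeOne_equification hI]; exact (F.ε x).2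
      obtain ⟨t, ht, htx⟩ := (Ideal.mem_map_iff_of_surjective π hπ).mp hx
      obtain ⟨y, hy⟩ := G.ε_surjective ⟨t, ht⟩
      refine ⟨π ∘ y, ?_⟩
      rw [hε']
      ext1 k
      change π (G.ε y : MvPolynomial (Option σ) K) = F.ε x
      rw [hy, htx]
    · rintro _ ⟨x, rfl⟩
      obtain ⟨v, rfl⟩ : ∃ v, π ∘ v = x := hπ.comp_left x
      have hv : π (G.ε v : MvPolynomial (Option σ) K) ∈ I := by
        have h := Ideal.mem_map_of_mem π (G.ε v).2
        rwa [map_specializeOne_equification hI] at h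
      obtain ⟨y, hy⟩ := F.ε_surjective ⟨_, hv⟩
      refine ⟨y, ?_⟩
      rw [hε']
      ext1 k
      exact congrArg Subtype.val hy

end Betti

/-! ### Existence of minimal graded free resolutions -/

section Existence

variable {σ K : Type*} [Field K]

theorem weight_one_eq_degree (m : σ →₀ ℕ) :
    Finsupp.weight (fun _ => (1 : ℤ)) m = (m.degree : ℤ) := by
  simp [Finsupp.weight_apply, Finsupp.degree_apply, Finsupp.sum]

/-- The homogeneous component of degree `t` of a vector in a graded free module. -/
noncomputable def vecComponent {r : ℕ} (s : Fin r → ℤ) (t : ℤ) :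
    (Fin r → MvPolynomial σ K) →ₗ[K] (Fin r → MvPolynomial σ K) :=
  LinearMap.pi fun k =>
    weightedHomogeneousComponent (fun _ => (1 : ℤ)) (t - s k) ∘ₗ LinearMap.proj k

theorem coeff_vecComponent {r : ℕ} (s : Fin r → ℤ) (t : ℤ) (v : Fin r → MvPolynomial σ K)
    (k : Fin r) (m : σ →₀ ℕ) :
    coeff m (vecComponent s t v k) = if (m.degree : ℤ) + s k = t then coeff m (v k) else 0 := by
  simp only [vecComponent, LinearMap.pi_apply, LinearMap.comp_apply, LinearMap.proj_apply,
    coeff_weightedHomogeneousComponent, weight_one_eq_degree, eq_sub_iff_add_eq]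

theorem isHomogeneousVec_vecComponent {r : ℕ} (s : Fin r → ℤ) (t : ℤ)
    (v : Fin r → MvPolynomial σ K) : IsHomogeneousVec s t (vecComponent s t v) := by
  intro k m hm
  by_contra h
  rw [mem_support_iff, coeff_vecComponent, if_neg h] at hm
  exact hm rfl

theorem IsHomogeneousVec.vecComponent_eq {r : ℕ} {s : Fin r → ℤ} {u : ℤ}
    {v : Fin r → MvPolynomial σ K} (hv : IsHomogeneousVec s u v) (t : ℤ) :
    vecComponent s t v = if u = t then v else 0 := by
  ext k m
  rw [coeff_vecComponent]
  by_cases hm : m ∈ (v k).support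
  · rw [hv k m hm]
    split_ifs <;> simp
  · rw [notMem_support_iff] at hm
    split_ifs <;> simp [hm]

theorem exists_sum_vecComponent_eq {r : ℕ} (s : Fin r → ℤ) (v : Fin r → MvPolynomial σ K) :
    ∃ S : Finset ℤ, ∀ S', S ⊆ S' → ∑ t ∈ S', vecComponent s t v = v := by
  classical
  refine ⟨Finset.univ.biUnion fun k => (v k).support.image fun m => (m.degree : ℤ) + s k,
    fun S' hS => ?_⟩
  ext k m
  rw [Finset.sum_apply, coeff_sum]
  simp only [coeff_vecComponent]
  rw [Finset.sum_ite_eq]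
  split_ifs with h
  · rfl
  · by_contra hne
    exact h (hS (Finset.mem_biUnion.mpr ⟨k, Finset.mem_univ _, Finset.mem_image.mpr
      ⟨m, mem_support_iff.mpr (Ne.symm hne), rfl⟩⟩))

theorem map_vecComponent {r r' : ℕ} {s : Fin r → ℤ} {s' : Fin r' → ℤ}
    (φ : (Fin r' → MvPolynomial σ K) →ₗ[MvPolynomial σ K] (Fin r → MvPolynomial σ K))
    (hφ : ∀ t v, IsHomogeneousVec s' t v → IsHomogeneousVec s t (φ v)) (t : ℤ)
    (v : Fin r' → MvPolynomial σ K) :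
    φ (vecComponent s' t v) = vecComponent s t (φ v) := by
  obtain ⟨S, hS⟩ := exists_sum_vecComponent_eq s' v
  -- Inserting `t` ensures that the degree `t` term occurs in the sum.
  conv_rhs => rw [← hS (insert t S) (Finset.subset_insert t S)]
  rw [map_sum, map_sum, Finset.sum_congr rfl fun u _ =>
    (hφ u _ (isHomogeneousVec_vecComponent s' u v)).vecComponent_eq t, Finset.sum_ite_eq',
    if_pos (Finset.mem_insert_self t S)]

theorem isHomogeneousVec_linearCombination {r r' : ℕ} {s : Fin r → ℤ} {s' : Fin r' → ℤ}
    {w : Fin r' → Fin r → MvPolynomial σ K} (hw : ∀ k, IsHomogeneousVec s (s' k) (w k)) {t : ℤ}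
    {v : Fin r' → MvPolynomial σ K} (hv : IsHomogeneousVec s' t v) :
    IsHomogeneousVec s t (Fintype.linearCombination (MvPolynomial σ K) w v) := by
  classical
  intro j m hm
  rw [Fintype.linearCombination_apply, Finset.sum_apply] at hm
  obtain ⟨k, -, hk⟩ := Finset.mem_biUnion.mp (support_sum hm)
  obtain ⟨a, ha, b, hb, rfl⟩ := Finset.mem_add.mp (support_mul _ _ hk)
  have h1 := hv k a ha
  have h2 := hw k j b hb
  rw [map_add]
  push_cast
  omega

/-- A graded submodule of a graded free module. -/
def IsGradedSubmodule {r : ℕ} (s : Fin r → ℤ)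
    (N : Submodule (MvPolynomial σ K) (Fin r → MvPolynomial σ K)) : Prop :=
  ∀ v ∈ N, ∀ t, vecComponent s t v ∈ N

theorem isGradedSubmodule_ker {r r' : ℕ} {s : Fin r → ℤ} {s' : Fin r' → ℤ}
    (φ : (Fin r' → MvPolynomial σ K) →ₗ[MvPolynomial σ K] (Fin r → MvPolynomial σ K))
    (hφ : ∀ t v, IsHomogeneousVec s' t v → IsHomogeneousVec s t (φ v)) :
    IsGradedSubmodule s' (LinearMap.ker φ) := by
  intro v hv t
  rw [LinearMap.mem_ker] at hv ⊢
  rw [map_vecComponent φ hφ, hv, map_zero]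

variable [Finite σ]

/-- Components of elements of `N` stay in `N`, so its homogeneous elements span it; noetherianity
extracts finitely many. -/
theorem IsGradedSubmodule.exists_homogeneous_generators {r : ℕ} {s : Fin r → ℤ}
    {N : Submodule (MvPolynomial σ K) (Fin r → MvPolynomial σ K)}
    (hN : IsGradedSubmodule s N) :
    ∃ (r' : ℕ) (s' : Fin r' → ℤ) (w : Fin r' → Fin r → MvPolynomial σ K),
      (∀ k, IsHomogeneousVec s (s' k) (w k)) ∧
        Submodule.span (MvPolynomial σ K) (Set.range w) = N := by
  have hspan : Submodule.span (MvPolynomial σ K) {x | x ∈ N ∧ ∃ t, IsHomogeneousVec s t x} = N := by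
    apply le_antisymm
    · rw [Submodule.span_le]
      exact fun x hx => hx.1
    · intro v hv
      obtain ⟨S, hS⟩ := exists_sum_vecComponent_eq s v
      rw [← hS S subset_rfl]
      exact Submodule.sum_mem _ fun t _ => Submodule.subset_span
        ⟨hN v hv t, t, isHomogeneousVec_vecComponent s t v⟩
  obtain ⟨A, hA, hAN⟩ := (Submodule.fg_span_iff_fg_span_finset_subset _).mp
    (hspan.symm ▸ IsNoetherian.noetherian N)
  choose t ht using fun x : A => (hA x.2).2
  refine ⟨A.card, fun k => t (A.equivFin.symm k), fun k => A.equivFin.symm k,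
    fun k => ht _, ?_⟩
  rw [← hspan, hAN]
  congr 1
  ext x
  constructor
  · rintro ⟨k, rfl⟩
    exact (A.equivFin.symm k).2
  · intro hx
    exact ⟨A.equivFin ⟨x, hx⟩, by simp⟩

/-- A graded submodule of a graded free module has a minimal graded free cover. -/
theorem IsGradedSubmodule.exists_minimal_cover {r : ℕ} {s : Fin r → ℤ}
    {N : Submodule (MvPolynomial σ K) (Fin r → MvPolynomial σ K)}
    (hN : IsGradedSubmodule s N) :
    ∃ (r' : ℕ) (s' : Fin r' → ℤ)
      (φ : (Fin r' → MvPolynomial σ K) →ₗ[MvPolynomial σ K] (Fin r → MvPolynomial σ K)),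
      (∀ t v, IsHomogeneousVec s' t v → IsHomogeneousVec s t (φ v)) ∧ LinearMap.range φ = N ∧
        LinearMap.ker φ ≤ idealOfVars σ K • ⊤ := by
  classical
  have hex := hN.exists_homogeneous_generators
  obtain ⟨s', w, hw, hwN⟩ := Nat.find_spec hex
  have hmin := fun {m} => Nat.find_min (m := m) hex
  generalize Nat.find hex = r' at s' w hmin
  have hφ := fun t v => isHomogeneousVec_linearCombination (t := t) (v := v) hw
  refine ⟨r', s', Fintype.linearCombination (MvPolynomial σ K) w, hφ, ?_, fun c hc => ?_⟩
  · rw [Fintype.range_linearCombination, hwN]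
  refine mem_smul_top_of_forall_mem fun k => mem_idealOfVars_iff.mpr ?_
  -- If a relation `c` has a nonzero constant term at `k`, its component of degree `s' k` has a
  -- nonzero scalar there. Then `w k` is a combination of the other generators, contradicting the
  -- minimality of `r'`.
  by_contra hk
  have hc' := isGradedSubmodule_ker _ hφ c hc (s' k)
  have hck : vecComponent s' (s' k) c k = C (coeff 0 (c k)) := by
    ext m
    rw [coeff_vecComponent, coeff_C]
    by_cases hm : m = 0
    · simp [hm]
    · rw [if_neg, if_neg (Ne.symm hm)]
      rwa [add_eq_right, Nat.cast_eq_zero, Finsupp.degree_eq_zero_iff]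
  rw [LinearMap.mem_ker, Fintype.linearCombination_apply] at hc'
  generalize vecComponent s' (s' k) c = b at hc' hck
  cases r' with
  | zero => exact k.elim0
  | succ n =>
    refine hmin (Nat.lt_succ_self n) ⟨s' ∘ k.succAbove, w ∘ k.succAbove, fun j => hw _, ?_⟩
    rw [← hwN]
    apply le_antisymm
    · exact Submodule.span_mono (Set.range_comp_subset_range _ _)
    · rw [Submodule.span_le]
      have hmem : ∀ j, w (k.succAbove j) ∈
          Submodule.span (MvPolynomial σ K) (Set.range (w ∘ k.succAbove)) :=
        fun j => Submodule.subset_span ⟨j, rfl⟩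
      rintro _ ⟨j, rfl⟩
      obtain rfl | ⟨j, rfl⟩ := k.eq_self_or_eq_succAbove j
      · rw [Fin.sum_univ_succAbove _ j, hck] at hc'
        have hj : w j = (C (coeff 0 (c j))⁻¹ : MvPolynomial σ K) •
            (C (coeff 0 (c j)) : MvPolynomial σ K) • w j := by
          rw [smul_smul, ← C_mul, inv_mul_cancel₀ hk, C_1, one_smul]
        rw [SetLike.mem_coe, hj, eq_neg_of_add_eq_zero_left hc']
        exact Submodule.smul_mem _ _ (neg_mem (Submodule.sum_mem _ fun i _ =>
          Submodule.smul_mem _ _ (hmem i)))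
      · exact hmem j

/-- A graded submodule of a graded free module, bundled with the ambient module. -/
structure GradedSubmodule (σ K : Type*) [Field K] where
  rank : ℕ
  shift : Fin rank → ℤ
  carrier : Submodule (MvPolynomial σ K) (Fin rank → MvPolynomial σ K)
  graded : IsGradedSubmodule shift carrier

namespace GradedSubmodule

/-- The kernel of a minimal graded free cover. -/
noncomputable def syzygy (N : GradedSubmodule σ K) : GradedSubmodule σ K where
  rank := N.graded.exists_minimal_cover.choose
  shift := N.graded.exists_minimal_cover.choose_spec.choose
  carrier := LinearMap.ker N.graded.exists_minimal_cover.choose_spec.choose_spec.choose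
  graded := isGradedSubmodule_ker _
    N.graded.exists_minimal_cover.choose_spec.choose_spec.choose_spec.1

/-- A minimal graded free cover. -/
noncomputable def cover (N : GradedSubmodule σ K) :
    (Fin N.syzygy.rank → MvPolynomial σ K) →ₗ[MvPolynomial σ K]
      (Fin N.rank → MvPolynomial σ K) :=
  N.graded.exists_minimal_cover.choose_spec.choose_spec.choose

theorem cover_graded (N : GradedSubmodule σ K) (t : ℤ) (v : Fin N.syzygy.rank → MvPolynomial σ K)
    (hv : IsHomogeneousVec N.syzygy.shift t v) : IsHomogeneousVec N.shift t (N.cover v) :=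
  N.graded.exists_minimal_cover.choose_spec.choose_spec.choose_spec.1 t v hv

theorem range_cover (N : GradedSubmodule σ K) : LinearMap.range N.cover = N.carrier :=
  N.graded.exists_minimal_cover.choose_spec.choose_spec.choose_spec.2.1

theorem ker_cover (N : GradedSubmodule σ K) : LinearMap.ker N.cover = N.syzygy.carrier :=
  rfl

theorem syzygy_le (N : GradedSubmodule σ K) : N.syzygy.carrier ≤ idealOfVars σ K • ⊤ :=
  N.graded.exists_minimal_cover.choose_spec.choose_spec.choose_spec.2.2

theorem exact_cover_syzygy (N : GradedSubmodule σ K) :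
    Function.Exact N.syzygy.cover N.cover := by
  rw [LinearMap.exact_iff, range_cover, ker_cover]

end GradedSubmodule

/-- A monomial ideal as a graded submodule of the free module of rank one. -/
noncomputable def IsMonomialIdeal.toGradedSubmodule {I : Ideal (MvPolynomial σ K)}
    (hI : IsMonomialIdeal I) : GradedSubmodule σ K where
  rank := 1
  shift := 0
  carrier := Submodule.comap (LinearMap.proj 0) I
  graded := by
    intro v hv t
    refine hI.mem_iff.mpr fun m hm => hI.mem_iff.mp hv m ?_
    rw [mem_support_iff] at hm ⊢
    rw [LinearMap.proj_apply, coeff_vecComponent] at hm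
    exact fun h => hm (by simpa using fun _ => h)

theorem IsMonomialIdeal.nonempty_minimalGradedFreeResolution {I : Ideal (MvPolynomial σ K)}
    (hI : IsMonomialIdeal I) : Nonempty (MinimalGradedFreeResolution I) := by
  -- `N 0` is the ideal and `N (i + 1)` sits inside the `i`-th free module, whence the index shift
  -- below.
  let N : ℕ → GradedSubmodule σ K := fun i =>
    Nat.rec hI.toGradedSubmodule (fun _ M => M.syzygy) i
  have hmem : ∀ x, (N 0).cover x (0 : Fin 1) ∈ I := fun x => by
    have : (N 0).cover x ∈ (N 0).carrier := (N 0).range_cover ▸ LinearMap.mem_range_self _ x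
    exact this
  let ε : (Fin (N 1).rank → MvPolynomial σ K) →ₗ[MvPolynomial σ K] I :=
    (LinearMap.proj (0 : Fin 1) ∘ₗ (N 0).cover).codRestrict I hmem
  have hε : ∀ x, ε x = 0 ↔ (N 0).cover x = 0 := fun x => by
    rw [Subtype.ext_iff]
    exact ⟨fun h => _root_.funext fun k => (Subsingleton.elim (α := Fin 1) k 0) ▸ h,
      fun h => congrFun h _⟩
  refine ⟨{
    rank := fun i => (N (i + 1)).rank
    shift := fun i => (N (i + 1)).shift
    d := fun i => (N (i + 1)).cover
    ε := ε
    ε_surjective := ?_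
    exact_zero := fun x => (hε x).trans ((N 0).exact_cover_syzygy x)
    exact_succ := fun i => (N (i + 1)).exact_cover_syzygy
    d_graded := fun i => (N (i + 1)).cover_graded
    ε_graded := fun t v hv m hm => ?_
    minimal := fun i => (N (i + 1)).range_cover.trans_le (N i).syzygy_le }⟩
  · intro p
    have : (fun _ => (p : MvPolynomial σ K)) ∈ (N 0).carrier := p.2
    rw [← (N 0).range_cover] at this
    obtain ⟨x, hx⟩ := this
    exact ⟨x, Subtype.ext (congrFun hx (0 : Fin 1))⟩
  · exact (add_zero _).symm.trans ((N 0).cover_graded t v hv (0 : Fin 1) m hm)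

end Existence

end MonomialEquification

theorem proposition5p12 {K : Type*} [Field K] (n : ℕ)
    (I : Ideal (MvPolynomial (Fin n) K)) (hI : MonomialEquification.IsMonomialIdeal I) :
    Nonempty (MonomialEquification.MinimalGradedFreeResolution I) ∧
    Nonempty (MonomialEquification.MinimalGradedFreeResolution
      (MonomialEquification.equification I)) ∧
    ∀ (F : MonomialEquification.MinimalGradedFreeResolution I)
      (G : MonomialEquification.MinimalGradedFreeResolution
        (MonomialEquification.equification I)),
      F.betti 0 = G.betti 0 ∧ ∀ i : ℕ, 0 < i → F.betti i ≤ G.betti i := by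
  refine ⟨hI.nonempty_minimalGradedFreeResolution,
    (MonomialEquification.isMonomialIdeal_equification I).nonempty_minimalGradedFreeResolution,
    fun F G => ?_⟩
  simp only [MonomialEquification.MinimalGradedFreeResolution.betti_eq_rank]
  refine ⟨le_antisymm (MonomialEquification.rank_le_rank_equification hI F G 0) ?_,
    fun i _ => MonomialEquification.rank_le_rank_equification hI F G i⟩
  exact (MonomialEquification.rank_zero_equification_le G).trans
    (MonomialEquification.ncard_minGens_le hI F.ε F.ε_surjective)
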